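/- Let $\mathbb{K}$ be an algebraically closed field and $V$ a nonzero finite-dimensional $\mathbb{K}$-vector space. Let $\Phi=(A;\{E_i\}_{i=0}^d;A^*;\{E_i^*\}_{i=0}^d)$ be a tridiagonal system on $V$ of diameter $d\ge 1$. That is: (1) $A,A^*\in\mathrm{End}(V)$ are diagonalizable, and no subspace $W\ne 0,V$ satisfies $AW\subseteq W$ and $A^*W\subseteq W$; (2) $E_0,\dots,E_d$ (resp. $E_0^*,\dots,E_d^*$) are the projections onto the eigenspaces of $A$ (resp. $A^*$), each taken along the sum of the other eigenspaces and listed without repetition; (3) $A^*E_iV\subseteq E_{i-1}V+E_iV+E_{i+1}V$ and $AE_i^*V\subseteq E_{i-1}^*V+E_i^*V+E_{i+1}^*V$ for $0\le i\le d$, where $E_{-1}=E_{d+1}=E^*_{-1}=E^*_{d+1}=0$. Assume that $\Phi$ has $q$-Racah type: there are nonzero $q,a,b\in\mathbb{K}$ with $q^4\neq 1$ such that, for $0\le i\le d$, the eigenvalue of $A$ on $E_iV$ is $aq^{d-2i}+a^{-1}q^{2i-d}$ and the eigenvalue of $A^*$ on $E_i^*V$ is $bq^{d-2i}+b^{-1}q^{2i-d}$.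 For $0\le i\le d$ put $$U_i=(E_0^*V+\cdots+E_i^*V)\cap(E_iV+\cdots+E_dV),\qquad U_i^{\Downarrow}=(E_0^*V+\cdots+E_i^*V)\cap(E_0V+\cdots+E_{d-i}V),$$ and for $0\le i\le d/2$ put $K_i=(E_0^*V+\cdots+E_i^*V)\cap(E_iV+\cdots+E_{d-i}V)$. Then there are unique invertible $K,B\in\mathrm{End}(V)$ such that $(K-q^{d-2i}I)U_i=0$ and $(B-q^{d-2i}I)U_i^{\Downarrow}=0$ for $0\le i\le d$. Put $R=A-aK-a^{-1}K^{-1}$ and $R^{\Downarrow}=A-a^{-1}B-aB^{-1}$. There is a unique $\psi\in\mathrm{End}(V)$ such that $\psi R-R\psi=(q-q^{-1})(K-K^{-1})$ and $\psi K_i=0$ for $0\le i\le d/2$. Let $U_q(\mathfrak{sl}_2)$ be the $\mathbb{K}$-algebra with generators $e,f,k,k^{-1}$ and relations $kk^{-1}=k^{-1}k=1$, $kek^{-1}=q^2e$, $kfk^{-1}=q^{-2}f$, $ef-fe=\frac{k-k^{-1}}{q-q^{-1}}$, and let $\Lambda=(q-q^{-1})^2ef+q^{-1}k+qk^{-1}$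 be its normalized Casimir element. Then each of the following two prescriptions defines a (unique) $U_q(\mathfrak{sl}_2)$-module structure on $V$: 1. $e,f,k,k^{-1}$ act as $(q-q^{-1})^{-1}\psi,\ (q-q^{-1})^{-1}R,\ K,\ K^{-1}$; 2. $e,f,k,k^{-1}$ act as $(q-q^{-1})^{-1}\psi,\ (q-q^{-1})^{-1}R^{\Downarrow},\ B,\ B^{-1}$. Moreover, the action of $\Lambda$ on $V$ is the same for these two module structures. -/

import Mathlib

/-! Tridiagonal systems of `q`-Racah type, their split decompositions, and `U_q(sl_2)`. -/

section TridiagonalSystems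

variable {𝕂 V : Type*} [Field 𝕂] [AddCommGroup V] [Module 𝕂 V]

/-- `W` is an eigenspace of `A`: it is nonzero and of the form `{v | A v = θ v}`. -/
def IsEigenspaceOf (A : Module.End 𝕂 V) (W : Submodule 𝕂 V) : Prop :=
  W ≠ ⊥ ∧ ∃ θ : 𝕂, W = Module.End.eigenspace A θ

/-- `V` is spanned by the eigenspaces of `A`. -/
def IsDiagonalizableEnd (A : Module.End 𝕂 V) : Prop :=
  sSup {W : Submodule 𝕂 V | IsEigenspaceOf A W} = ⊤

/-- `W 0, …, W d` is an ordering (without repetition) of all the eigenspaces of `A`, and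
`A'` maps `W i` into `W (i-1) + W i + W (i+1)`, where `W (-1) = W (d+1) = 0`. -/
structure IsStandardOrdering (A A' : Module.End 𝕂 V) {d : ℕ}
    (W : Fin (d + 1) → Submodule 𝕂 V) : Prop where
  injective : Function.Injective W
  range_eq : Set.range W = {X : Submodule 𝕂 V | IsEigenspaceOf A X}
  tridiagonal : ∀ i : Fin (d + 1), (W i).map A' ≤
    ⨆ j : Fin (d + 1), ⨆ _ : (j : ℕ) ≤ (i : ℕ) + 1 ∧ (i : ℕ) ≤ (j : ℕ) + 1, W j

/-- Tridiagonal pairs. -/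
structure IsTridiagonalPair (A A' : Module.End 𝕂 V) : Prop where
  diagonalizable : IsDiagonalizableEnd A
  diagonalizable' : IsDiagonalizableEnd A'
  exists_ordering : ∃ (d : ℕ) (W : Fin (d + 1) → Submodule 𝕂 V), IsStandardOrdering A A' W
  exists_ordering' : ∃ (δ : ℕ) (W : Fin (δ + 1) → Submodule 𝕂 V), IsStandardOrdering A' A W
  irreducible : ¬ ∃ W : Submodule 𝕂 V,
    W.map A ≤ W ∧ W.map A' ≤ W ∧ W ≠ ⊥ ∧ W ≠ ⊤

/-- `E 0, …, E d` is a standard ordering of the primitive idempotents of `A`: the subspaces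
`E i V` are a standard ordering of the eigenspaces of `A`, and `E i` is the projection onto
`E i V` that vanishes on `E j V` for `j ≠ i`. -/
structure IsStandardIdempotentOrdering (A A' : Module.End 𝕂 V) {d : ℕ}
    (E : Fin (d + 1) → Module.End 𝕂 V) : Prop where
  standard : IsStandardOrdering A A' (fun i => LinearMap.range (E i))
  apply_self : ∀ i, ∀ v ∈ LinearMap.range (E i), E i v = v
  apply_of_ne : ∀ i j, i ≠ j → ∀ v ∈ LinearMap.range (E j), E i v = 0

variable (𝕂 V) in
/-- Tridiagonal systems `(A; E 0, …, E d; A'; E' 0, …, E' d)` of diameter `d` on `V`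
(`A'`, `E'` are usually written `A^*`, `E^*`). -/
structure TDSystem (d : ℕ) where
  A : Module.End 𝕂 V
  E : Fin (d + 1) → Module.End 𝕂 V
  A' : Module.End 𝕂 V
  E' : Fin (d + 1) → Module.End 𝕂 V
  isTridiagonalPair : IsTridiagonalPair A A'
  standard : IsStandardIdempotentOrdering A A' E
  standard' : IsStandardIdempotentOrdering A' A E'

theorem IsStandardIdempotentOrdering.rev {A A' : Module.End 𝕂 V} {d : ℕ}
    {E : Fin (d + 1) → Module.End 𝕂 V} (h : IsStandardIdempotentOrdering A A' E) :
    IsStandardIdempotentOrdering A A' (fun i => E i.rev) where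
  standard :=
    { injective := fun i j hij => Fin.rev_injective (h.standard.injective hij)
      range_eq := by
        rw [← h.standard.range_eq]
        exact Fin.rev_surjective.range_comp (fun i => LinearMap.range (E i))
      tridiagonal := by
        intro i
        refine (h.standard.tridiagonal i.rev).trans (iSup₂_le fun j hj => ?_)
        refine le_iSup₂_of_le j.rev ?_ (by rw [Fin.rev_rev])
        have h1 := Fin.val_rev i
        have h2 := Fin.val_rev j
        omega }
  apply_self := fun i => h.apply_self i.rev
  apply_of_ne := fun i j hij => h.apply_of_ne i.rev j.rev (fun e => hij (Fin.rev_injective e))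

namespace TDSystem

variable {d : ℕ}

/-- The second inversion `Φ^⇓ = (A; E d, …, E 0; A'; E' 0, …, E' d)`. -/
def secondInversion (Φ : TDSystem 𝕂 V d) : TDSystem 𝕂 V d where
  A := Φ.A
  E := fun i => Φ.E i.rev
  A' := Φ.A'
  E' := Φ.E'
  isTridiagonalPair := Φ.isTridiagonalPair
  standard := Φ.standard.rev
  standard' := Φ.standard'

/-- `Φ` has `q`-Racah type with parameters `q, a, b`: the eigenvalue of `A` on `E i V` is
`a q^(d-2i) + a⁻¹ q^(2i-d)`, and that of `A'` on `E' i V` is `b q^(d-2i) + b⁻¹ q^(2i-d)`. -/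
structure IsQRacah (Φ : TDSystem 𝕂 V d) (q a b : 𝕂) : Prop where
  q_ne_zero : q ≠ 0
  a_ne_zero : a ≠ 0
  b_ne_zero : b ≠ 0
  q_pow_four_ne_one : q ^ 4 ≠ 1
  eigenvalue : ∀ i : Fin (d + 1), ∀ v ∈ LinearMap.range (Φ.E i),
    Φ.A v = (a * q ^ ((d : ℤ) - 2 * (i : ℤ)) + a⁻¹ * q ^ (2 * (i : ℤ) - (d : ℤ))) • v
  eigenvalue' : ∀ i : Fin (d + 1), ∀ v ∈ LinearMap.range (Φ.E' i),
    Φ.A' v = (b * q ^ ((d : ℤ) - 2 * (i : ℤ)) + b⁻¹ * q ^ (2 * (i : ℤ) - (d : ℤ))) • v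

/-- `U i = (E' 0 V + ⋯ + E' i V) ∩ (E i V + ⋯ + E d V)`, the components of the first split
decomposition. The second split decomposition is `Φ.secondInversion.U`. -/
def U (Φ : TDSystem 𝕂 V d) (i : Fin (d + 1)) : Submodule 𝕂 V :=
  (⨆ j : Fin (d + 1), ⨆ _ : j ≤ i, LinearMap.range (Φ.E' j)) ⊓
    (⨆ j : Fin (d + 1), ⨆ _ : i ≤ j, LinearMap.range (Φ.E j))

/-- `K_i = (E' 0 V + ⋯ + E' i V) ∩ (E i V + ⋯ + E (d-i) V)`, used for `0 ≤ i ≤ d / 2`. -/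
def kSpace (Φ : TDSystem 𝕂 V d) (i : ℕ) : Submodule 𝕂 V :=
  (⨆ j : Fin (d + 1), ⨆ _ : (j : ℕ) ≤ i, LinearMap.range (Φ.E' j)) ⊓
    (⨆ j : Fin (d + 1), ⨆ _ : i ≤ (j : ℕ) ∧ (j : ℕ) + i ≤ d, LinearMap.range (Φ.E j))

/-- The defining property of `K`: `(K - q^(d-2i) I) U_i = 0` for `0 ≤ i ≤ d`.
For `Φ.secondInversion` this is the defining property of `B`. -/
def IsK (Φ : TDSystem 𝕂 V d) (q : 𝕂) (K : Module.End 𝕂 V) : Prop :=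
  ∀ i : Fin (d + 1), ∀ v ∈ Φ.U i, K v = q ^ ((d : ℤ) - 2 * (i : ℤ)) • v

/-- `R = A - a K - a⁻¹ K⁻¹`. For `Φ.secondInversion`, `a⁻¹` and `B` this is `R^⇓`. -/
def R (Φ : TDSystem 𝕂 V d) (a : 𝕂) (K : (Module.End 𝕂 V)ˣ) : Module.End 𝕂 V :=
  Φ.A - a • (K : Module.End 𝕂 V) - a⁻¹ • ((K⁻¹ : (Module.End 𝕂 V)ˣ) : Module.End 𝕂 V)

/-- The defining property of `ψ`: `ψ R - R ψ = (q - q⁻¹) (K - K⁻¹)`, and `ψ K_i = 0` for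
`0 ≤ i ≤ d / 2`. -/
def IsPsi (Φ : TDSystem 𝕂 V d) (q a : 𝕂) (K : (Module.End 𝕂 V)ˣ)
    (ψ : Module.End 𝕂 V) : Prop :=
  ψ * Φ.R a K - Φ.R a K * ψ =
      (q - q⁻¹) • ((K : Module.End 𝕂 V) - ((K⁻¹ : (Module.End 𝕂 V)ˣ) : Module.End 𝕂 V)) ∧
    ∀ i : ℕ, 2 * i ≤ d → ∀ v ∈ Φ.kSpace i, ψ v = 0

end TDSystem

end TridiagonalSystems

section QuantumGroup

variable {𝕂 : Type*} [Field 𝕂]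

/-- The Chevalley generators of `U_q(sl_2)`. -/
inductive UqGen : Type
  | e
  | f
  | k
  | kinv

/-- The defining relations of `U_q(sl_2)`, as relations on the free algebra. -/
inductive UqRel (q : 𝕂) : FreeAlgebra 𝕂 UqGen → FreeAlgebra 𝕂 UqGen → Prop
  | k_mul_kinv : UqRel q (FreeAlgebra.ι 𝕂 UqGen.k * FreeAlgebra.ι 𝕂 UqGen.kinv) 1
  | kinv_mul_k : UqRel q (FreeAlgebra.ι 𝕂 UqGen.kinv * FreeAlgebra.ι 𝕂 UqGen.k) 1
  | k_e : UqRel q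
      (FreeAlgebra.ι 𝕂 UqGen.k * FreeAlgebra.ι 𝕂 UqGen.e * FreeAlgebra.ι 𝕂 UqGen.kinv)
      (q ^ 2 • FreeAlgebra.ι 𝕂 UqGen.e)
  | k_f : UqRel q
      (FreeAlgebra.ι 𝕂 UqGen.k * FreeAlgebra.ι 𝕂 UqGen.f * FreeAlgebra.ι 𝕂 UqGen.kinv)
      ((q ^ 2)⁻¹ • FreeAlgebra.ι 𝕂 UqGen.f)
  | e_f : UqRel q
      (FreeAlgebra.ι 𝕂 UqGen.e * FreeAlgebra.ι 𝕂 UqGen.f -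
        FreeAlgebra.ι 𝕂 UqGen.f * FreeAlgebra.ι 𝕂 UqGen.e)
      ((q - q⁻¹)⁻¹ • (FreeAlgebra.ι 𝕂 UqGen.k - FreeAlgebra.ι 𝕂 UqGen.kinv))

/-- The algebra `U_q(sl_2)` (meaningful for `q ≠ 0` and `q ^ 2 ≠ 1`). -/
abbrev Uq (q : 𝕂) : Type _ := RingQuot (UqRel q)

namespace Uq

/-- The image in `U_q(sl_2)` of a generator. -/
noncomputable def gen (q : 𝕂) (g : UqGen) : Uq q :=
  RingQuot.mkAlgHom 𝕂 (UqRel q) (FreeAlgebra.ι 𝕂 g)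

/-- The normalized Casimir element `Λ = (q - q⁻¹)² e f + q⁻¹ k + q k⁻¹`. -/
noncomputable def casimir (q : 𝕂) : Uq q :=
  (q - q⁻¹) ^ 2 • (gen q UqGen.e * gen q UqGen.f) + q⁻¹ • gen q UqGen.k + q • gen q UqGen.kinv

/-- The algebra homomorphism `ρ` gives the `U_q(sl_2)`-module structure on `V` for which
`e, f, k, k⁻¹` act as `(q - q⁻¹)⁻¹ ψ`, `(q - q⁻¹)⁻¹ R`, `K`, `K⁻¹`. -/
structure ActsBy {V : Type*} [AddCommGroup V] [Module 𝕂 V] (q : 𝕂)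
    (ρ : Uq q →ₐ[𝕂] Module.End 𝕂 V) (ψ R : Module.End 𝕂 V) (K : (Module.End 𝕂 V)ˣ) : Prop where
  e : ρ (gen q UqGen.e) = (q - q⁻¹)⁻¹ • ψ
  f : ρ (gen q UqGen.f) = (q - q⁻¹)⁻¹ • R
  k : ρ (gen q UqGen.k) = (K : Module.End 𝕂 V)
  kinv : ρ (gen q UqGen.kinv) = ((K⁻¹ : (Module.End 𝕂 V)ˣ) : Module.End 𝕂 V)

end Uq

end QuantumGroup

/-! The operator `R` raises the split decomposition `U_0, …, U_d` by one step and has the hard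
Lefschetz property: `R^(d-2i) : U_i → U_(d-i)` is bijective. Injectivity holds because a kernel
vector lies in `(E' 0 V + ⋯ + E' i V) ∩ (E 0 V + ⋯ + E (d-i-1) V)`, which vanishes by
irreducibility; the same argument for the dual system gives equality of dimensions. So `V` is the
direct sum of strings `R^m K_i`, `0 ≤ m ≤ d - 2i`, where `K_i` consists of the primitive vectors
of `U_i`. On each string the commutation relation forces `ψ R^m v = c_m R^(m-1) v`, and this is
consistent at the end of the string, which gives existence and uniqueness of `ψ` and the
`U_q(sl_2)` relations (`IsQRacah.existsUnique_isPsi`, `IsQRacah.isUqTriple`).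

The same applies to the second inversion, with `a` replaced by `a⁻¹`; it has the same spaces `K_i`
and yields an operator `ψ₂`. To see that `ψ = ψ₂`, note that the string through `v ∈ K_i` spans
`𝕂[A] v`, so it is enough to compare on the vectors `A^m v`. In any `U_q(sl_2)`-triple, `ψ` and
`A = R + a K + a⁻¹ K⁻¹` satisfy the Askey–Wilson relation `IsUqTriple.askeyWilson`

`A² ψ - (q² + q⁻²) A ψ A + ψ A² + (q² - q⁻²)² ψ = - (q - q⁻¹)² Λ A + const`,

in which the Casimir element `Λ` commutes with `A` and the constant is symmetric in `a` and `a⁻¹`.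
It determines `ψ A^(m+2) v` from `ψ A^m v`, `ψ A^(m+1) v` and `Λ v`. Since `ψ v`, `ψ A v` and `Λ v`
are given by formulas that do not involve `a`, both `ψ = ψ₂` and the equality of the two Casimir
actions follow (`IsQRacah.psi_eq_and_casimir_eq`). -/

/-! ### Primitive idempotents -/

section Idempotents

variable {𝕂 V : Type*} [Field 𝕂] [AddCommGroup V] [Module 𝕂 V] {d : ℕ}
  {A A' : Module.End 𝕂 V} {E : Fin (d + 1) → Module.End 𝕂 V}

namespace IsStandardIdempotentOrdering

theorem iSup_range_eq_top (h : IsStandardIdempotentOrdering A A' E)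
    (hA : IsDiagonalizableEnd A) : ⨆ i, LinearMap.range (E i) = ⊤ := by
  rw [← sSup_range, h.standard.range_eq]
  exact hA

theorem apply_apply_self (h : IsStandardIdempotentOrdering A A' E) (i : Fin (d + 1)) (v : V) :
    E i (E i v) = E i v :=
  h.apply_self i _ (LinearMap.mem_range_self _ _)

theorem apply_apply_of_ne (h : IsStandardIdempotentOrdering A A' E) {i j : Fin (d + 1)}
    (hij : i ≠ j) (v : V) : E i (E j v) = 0 :=
  h.apply_of_ne i j hij _ (LinearMap.mem_range_self _ _)

theorem sum_apply (h : IsStandardIdempotentOrdering A A' E) (hA : IsDiagonalizableEnd A)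
    (v : V) : ∑ i, E i v = v := by
  have key : (⊤ : Submodule 𝕂 V) ≤ LinearMap.ker ((∑ i, E i) - 1) := by
    rw [← h.iSup_range_eq_top hA, iSup_le_iff]
    rintro j _ ⟨v, rfl⟩
    rw [LinearMap.mem_ker, LinearMap.sub_apply, LinearMap.sum_apply, Finset.sum_eq_single j,
      h.apply_apply_self, Module.End.one_apply, sub_self]
    · intro i _ hij
      exact h.apply_apply_of_ne hij v
    · simp
  have := key (Submodule.mem_top (x := v))
  rwa [LinearMap.mem_ker, LinearMap.sub_apply, LinearMap.sum_apply, Module.End.one_apply,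
    sub_eq_zero] at this

theorem eq_zero_of_forall (h : IsStandardIdempotentOrdering A A' E)
    (hA : IsDiagonalizableEnd A) {v : V} (hv : ∀ j, E j v = 0) : v = 0 := by
  rw [← h.sum_apply hA v]
  exact Finset.sum_eq_zero fun j _ => hv j

/-- A sum of some of the eigenspaces is cut out by the vanishing of the other idempotents. -/
theorem mem_iSup_range_iff (h : IsStandardIdempotentOrdering A A' E)
    (hA : IsDiagonalizableEnd A) (P : Fin (d + 1) → Prop) (v : V) :
    v ∈ ⨆ j : Fin (d + 1), ⨆ _ : P j, LinearMap.range (E j) ↔ ∀ j, ¬ P j → E j v = 0 := by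
  constructor
  · intro hv j hj
    have : ⨆ j : Fin (d + 1), ⨆ _ : P j, LinearMap.range (E j) ≤ LinearMap.ker (E j) := by
      refine iSup₂_le fun k hk => ?_
      rintro _ ⟨w, rfl⟩
      refine h.apply_apply_of_ne ?_ w
      rintro rfl
      exact hj hk
    exact this hv
  · intro hv
    rw [← h.sum_apply hA v]
    refine Submodule.sum_mem _ fun j _ => ?_
    by_cases hj : P j
    · exact Submodule.mem_iSup_of_mem j (Submodule.mem_iSup_of_mem hj
        (LinearMap.mem_range_self _ _))
    · rw [hv j hj]
      exact Submodule.zero_mem _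

theorem exists_ne_zero (h : IsStandardIdempotentOrdering A A' E) (j : Fin (d + 1)) :
    ∃ v, E j v ≠ 0 := by
  have hj : IsEigenspaceOf A (LinearMap.range (E j)) := by
    have : LinearMap.range (E j) ∈ Set.range fun i => LinearMap.range (E i) := ⟨j, rfl⟩
    rwa [h.standard.range_eq] at this
  by_contra! hcon
  exact hj.1 (LinearMap.range_eq_bot.2 (LinearMap.ext hcon))

theorem range_eq_eigenspace (h : IsStandardIdempotentOrdering A A' E) {θ : Fin (d + 1) → 𝕂}
    (hθ : ∀ i, ∀ v ∈ LinearMap.range (E i), A v = θ i • v) (j : Fin (d + 1)) :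
    LinearMap.range (E j) = Module.End.eigenspace A (θ j) := by
  have hj : IsEigenspaceOf A (LinearMap.range (E j)) := by
    have : LinearMap.range (E j) ∈ Set.range fun i => LinearMap.range (E i) := ⟨j, rfl⟩
    rwa [h.standard.range_eq] at this
  obtain ⟨t, ht⟩ := hj.2
  obtain ⟨v, hv⟩ := h.exists_ne_zero j
  have h1 := hθ j (E j v) (LinearMap.mem_range_self _ _)
  have h2 : E j v ∈ Module.End.eigenspace A t := ht ▸ LinearMap.mem_range_self _ _
  rw [Module.End.mem_eigenspace_iff, h1] at h2
  rw [ht, smul_left_injective 𝕂 hv h2]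

theorem eigenvalue_injective (h : IsStandardIdempotentOrdering A A' E) {θ : Fin (d + 1) → 𝕂}
    (hθ : ∀ i, ∀ v ∈ LinearMap.range (E i), A v = θ i • v) : Function.Injective θ := by
  intro i j hij
  apply h.standard.injective
  simp only [h.range_eq_eigenspace hθ, hij]

theorem apply_comm (h : IsStandardIdempotentOrdering A A' E) (hA : IsDiagonalizableEnd A)
    {θ : Fin (d + 1) → 𝕂} (hθ : ∀ i, ∀ v ∈ LinearMap.range (E i), A v = θ i • v)
    (j : Fin (d + 1)) (v : V) : E j (A v) = θ j • E j v := by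
  conv_lhs => rw [← h.sum_apply hA v]
  rw [map_sum, map_sum, Finset.sum_eq_single j]
  · rw [hθ j _ (LinearMap.mem_range_self _ _), map_smul, h.apply_apply_self]
  · intro i _ hij
    rw [hθ i _ (LinearMap.mem_range_self _ _), map_smul, h.apply_apply_of_ne hij.symm, smul_zero]
  · simp

/-- The tridiagonal shape: if the components of `v` next to and at `j` vanish, so does the
`j`-th component of `A' v`. -/
theorem apply_apply_eq_zero (h : IsStandardIdempotentOrdering A A' E)
    (hA : IsDiagonalizableEnd A) (j : Fin (d + 1)) {v : V}
    (hv : ∀ k : Fin (d + 1), (j : ℕ) ≤ k + 1 → (k : ℕ) ≤ j + 1 → E k v = 0) :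
    E j (A' v) = 0 := by
  conv_lhs => rw [← h.sum_apply hA v]
  rw [map_sum, map_sum]
  refine Finset.sum_eq_zero fun k _ => ?_
  by_cases hk : (j : ℕ) ≤ k + 1 ∧ (k : ℕ) ≤ j + 1
  · rw [hv k hk.1 hk.2, map_zero, map_zero]
  · have := h.standard.tridiagonal k
      (Submodule.mem_map_of_mem (LinearMap.mem_range_self (E k) v))
    exact (h.mem_iSup_range_iff hA _ _).1 this j hk

end IsStandardIdempotentOrdering

end Idempotents

namespace TDSystem

variable {𝕂 V : Type*} [Field 𝕂] [AddCommGroup V] [Module 𝕂 V] {d : ℕ}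

/-! ### Split decompositions -/

/-- The vectors whose dual components lie in degrees at most `n` and whose components lie in
degrees at least `m`. The diagonal pieces `n = m` are the components of the split decomposition,
now indexed by all of `ℕ`; they vanish for `n > d`. -/
def splitPiece (Φ : TDSystem 𝕂 V d) (n m : ℕ) : Submodule 𝕂 V where
  carrier := {v | (∀ j : Fin (d + 1), n < (j : ℕ) → Φ.E' j v = 0) ∧
    ∀ j : Fin (d + 1), (j : ℕ) < m → Φ.E j v = 0}
  add_mem' := fun {v w} hv hw =>
    ⟨fun j hj => by rw [map_add, hv.1 j hj, hw.1 j hj, add_zero],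
      fun j hj => by rw [map_add, hv.2 j hj, hw.2 j hj, add_zero]⟩
  zero_mem' := ⟨fun _ _ => map_zero _, fun _ _ => map_zero _⟩
  smul_mem' := fun c v hv =>
    ⟨fun j hj => by rw [map_smul, hv.1 j hj, smul_zero],
      fun j hj => by rw [map_smul, hv.2 j hj, smul_zero]⟩

variable (Φ : TDSystem 𝕂 V d)

theorem mem_splitPiece {n m : ℕ} {v : V} : v ∈ Φ.splitPiece n m ↔
    (∀ j : Fin (d + 1), n < (j : ℕ) → Φ.E' j v = 0) ∧
      ∀ j : Fin (d + 1), (j : ℕ) < m → Φ.E j v = 0 := Iff.rfl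

theorem U_eq_splitPiece (i : Fin (d + 1)) : Φ.U i = Φ.splitPiece i i := by
  ext v
  rw [U, Submodule.mem_inf, Φ.standard'.mem_iSup_range_iff Φ.isTridiagonalPair.diagonalizable',
    Φ.standard.mem_iSup_range_iff Φ.isTridiagonalPair.diagonalizable, mem_splitPiece]
  simp only [not_le, Fin.lt_def]

theorem mem_kSpace {i : ℕ} {v : V} : v ∈ Φ.kSpace i ↔
    v ∈ Φ.splitPiece i i ∧ ∀ j : Fin (d + 1), d < (j : ℕ) + i → Φ.E j v = 0 := by
  rw [kSpace, Submodule.mem_inf, Φ.standard'.mem_iSup_range_iff Φ.isTridiagonalPair.diagonalizable',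
    Φ.standard.mem_iSup_range_iff Φ.isTridiagonalPair.diagonalizable, mem_splitPiece]
  simp only [not_le, not_and_or, or_imp, forall_and, and_assoc]

theorem splitPiece_eq_bot_of_lt {n m : ℕ} (h : d < m) : Φ.splitPiece n m = ⊥ := by
  refine (Submodule.eq_bot_iff _).2 fun v hv =>
    Φ.standard.eq_zero_of_forall Φ.isTridiagonalPair.diagonalizable fun j => hv.2 j ?_
  have := j.isLt
  omega

/-- The eigenvalue `a q^(d-2n) + a⁻¹ q^(2n-d)` attached to the index `n`, for all `n : ℕ`. -/
def racahEigenvalue (d : ℕ) (q a : 𝕂) (n : ℕ) : 𝕂 :=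
  a * q ^ ((d : ℤ) - 2 * (n : ℤ)) + a⁻¹ * q ^ (2 * (n : ℤ) - (d : ℤ))

variable {Φ} {q a b : 𝕂}

theorem IsQRacah.E_A (h : Φ.IsQRacah q a b) (j : Fin (d + 1)) (v : V) :
    Φ.E j (Φ.A v) = racahEigenvalue d q a j • Φ.E j v :=
  Φ.standard.apply_comm Φ.isTridiagonalPair.diagonalizable
    (θ := fun i => racahEigenvalue d q a i) h.eigenvalue j v

theorem IsQRacah.E'_A' (h : Φ.IsQRacah q a b) (j : Fin (d + 1)) (v : V) :
    Φ.E' j (Φ.A' v) = racahEigenvalue d q b j • Φ.E' j v :=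
  Φ.standard'.apply_comm Φ.isTridiagonalPair.diagonalizable'
    (θ := fun i => racahEigenvalue d q b i) h.eigenvalue' j v

theorem IsQRacah.racahEigenvalue_injOn (h : Φ.IsQRacah q a b) {i j : ℕ} (hi : i ≤ d)
    (hj : j ≤ d) (hij : racahEigenvalue d q a i = racahEigenvalue d q a j) : i = j := by
  have := Φ.standard.eigenvalue_injective
    (θ := fun i => racahEigenvalue d q a i) h.eigenvalue
    (a₁ := ⟨i, Nat.lt_succ_of_le hi⟩) (a₂ := ⟨j, Nat.lt_succ_of_le hj⟩) hij
  simpa using this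

theorem IsQRacah.A_sub_mem (h : Φ.IsQRacah q a b) {n m : ℕ} {v : V}
    (hv : v ∈ Φ.splitPiece n m) :
    Φ.A v - racahEigenvalue d q a m • v ∈ Φ.splitPiece (n + 1) (m + 1) := by
  refine ⟨fun j hj => ?_, fun j hj => ?_⟩
  · rw [map_sub, map_smul, hv.1 j (by omega), smul_zero, sub_zero]
    exact Φ.standard'.apply_apply_eq_zero Φ.isTridiagonalPair.diagonalizable' j
      fun k hk _ => hv.1 k (by omega)
  · rw [map_sub, map_smul, h.E_A, ← sub_smul]
    rcases Nat.lt_succ_iff_lt_or_eq.1 hj with hj | hj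
    · rw [hv.2 j hj, smul_zero]
    · rw [hj, sub_self, zero_smul]

theorem IsQRacah.A'_sub_mem (h : Φ.IsQRacah q a b) {n m : ℕ} {v : V}
    (hv : v ∈ Φ.splitPiece (n + 1) (m + 1)) :
    Φ.A' v - racahEigenvalue d q b (n + 1) • v ∈ Φ.splitPiece n m := by
  refine ⟨fun j hj => ?_, fun j hj => ?_⟩
  · rw [map_sub, map_smul, h.E'_A', ← sub_smul]
    rcases Nat.lt_or_eq_of_le (Nat.succ_le_of_lt hj) with hj | hj
    · rw [hv.1 j hj, smul_zero]
    · rw [← hj, Nat.succ_eq_add_one, sub_self, zero_smul]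
  · rw [map_sub, map_smul, hv.2 j (by omega), smul_zero, sub_zero]
    exact Φ.standard.apply_apply_eq_zero Φ.isTridiagonalPair.diagonalizable j
      fun k _ hk => hv.2 k (by omega)

theorem IsQRacah.A'_sub_eq_zero (h : Φ.IsQRacah q a b) {m : ℕ} {v : V}
    (hv : v ∈ Φ.splitPiece 0 m) : Φ.A' v - racahEigenvalue d q b 0 • v = 0 := by
  refine Φ.standard'.eq_zero_of_forall Φ.isTridiagonalPair.diagonalizable' fun j => ?_
  rw [map_sub, map_smul, h.E'_A', ← sub_smul]
  rcases Nat.eq_zero_or_pos j with hj | hj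
  · rw [hj, sub_self, zero_smul]
  · rw [hv.1 j hj, smul_zero]

/-- A diagonal sum of pieces is invariant under both transformations, hence trivial. -/
theorem IsQRacah.iSup_splitPiece_eq_bot_or_eq_top (h : Φ.IsQRacah q a b) (r : ℕ) :
    ⨆ n, Φ.splitPiece n (n + r) = ⊥ ∨ ⨆ n, Φ.splitPiece n (n + r) = ⊤ := by
  by_contra hcon
  rw [not_or] at hcon
  have hle : ∀ n, Φ.splitPiece n (n + r) ≤ ⨆ n, Φ.splitPiece n (n + r) := le_iSup _
  refine Φ.isTridiagonalPair.irreducible ⟨⨆ n, Φ.splitPiece n (n + r), ?_, ?_, hcon⟩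
  · rw [Submodule.map_iSup]
    refine iSup_le fun n => ?_
    rintro _ ⟨v, hv, rfl⟩
    have h1 : Φ.A v - racahEigenvalue d q a (n + r) • v ∈ Φ.splitPiece (n + 1) (n + 1 + r) := by
      rw [add_right_comm]
      exact h.A_sub_mem hv
    have := Submodule.add_mem _ (hle _ h1)
      (Submodule.smul_mem _ (racahEigenvalue d q a (n + r)) (hle _ hv))
    rwa [sub_add_cancel] at this
  · rw [Submodule.map_iSup]
    refine iSup_le fun n => ?_
    rintro _ ⟨v, hv, rfl⟩
    have h1 : Φ.A' v - racahEigenvalue d q b n • v ∈ ⨆ n, Φ.splitPiece n (n + r) := by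
      rcases n with _ | n
      · rw [h.A'_sub_eq_zero hv]
        exact Submodule.zero_mem _
      · rw [SetLike.mem_coe, add_right_comm] at hv
        exact hle _ (h.A'_sub_mem hv)
    have := Submodule.add_mem _ h1
      (Submodule.smul_mem _ (racahEigenvalue d q b n) (hle _ hv))
    rwa [sub_add_cancel] at this

theorem IsQRacah.splitPiece_eq_bot (h : Φ.IsQRacah q a b) {n m : ℕ} (hnm : n < m) :
    Φ.splitPiece n m = ⊥ := by
  obtain ⟨r, rfl⟩ := Nat.exists_eq_add_of_lt hnm
  rw [add_assoc]
  rcases h.iSup_splitPiece_eq_bot_or_eq_top (r + 1) with h0 | h0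
  · exact (iSup_eq_bot.1 h0) n
  · -- every piece of the diagonal lies in the kernel of the last dual idempotent
    exfalso
    obtain ⟨v, hv⟩ := Φ.standard'.exists_ne_zero (Fin.last d)
    have hle : ⨆ n, Φ.splitPiece n (n + (r + 1)) ≤ LinearMap.ker (Φ.E' (Fin.last d)) := by
      refine iSup_le fun n w hw => ?_
      by_cases hn : n < d
      · exact hw.1 (Fin.last d) hn
      · rw [Φ.splitPiece_eq_bot_of_lt (by omega), Submodule.mem_bot] at hw
        rw [hw]
        exact Submodule.zero_mem _
    rw [h0] at hle
    exact hv (hle Submodule.mem_top)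

theorem IsQRacah.iSup_splitPiece (h : Φ.IsQRacah q a b) : ⨆ n, Φ.splitPiece n n = ⊤ := by
  refine (h.iSup_splitPiece_eq_bot_or_eq_top 0).resolve_left fun h0 => ?_
  obtain ⟨v, hv⟩ := Φ.standard'.exists_ne_zero 0
  have hmem : Φ.E' 0 v ∈ Φ.splitPiece 0 0 := by
    refine ⟨fun j hj => Φ.standard'.apply_apply_of_ne ?_ v, fun j hj => absurd hj (by omega)⟩
    rintro rfl
    simp at hj
  have := (iSup_eq_bot.1 h0) 0
  rw [this, Submodule.mem_bot] at hmem
  exact hv hmem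

/-- The sum of the pieces `splitPiece n n` is direct. -/
theorem IsQRacah.eq_zero_of_sum_eq_zero (h : Φ.IsQRacah q a b) {u : Fin (d + 1) → V}
    (hu : ∀ n : Fin (d + 1), u n ∈ Φ.splitPiece n n) (hsum : ∑ n, u n = 0) (n : Fin (d + 1)) : u n = 0 := by
  induction n using WellFoundedLT.induction with
  | ind n ih =>
    -- applying `E n` to the relation shows that `u n` has no component in degree `n` either
    have hn : Φ.E n (u n) = 0 := by
      have := congrArg (Φ.E n) hsum
      rw [map_sum, map_zero, Finset.sum_eq_single n] at this
      · exact this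
      · intro k _ hk
        rcases lt_or_gt_of_ne hk with hk | hk
        · rw [ih k hk, map_zero]
        · exact (hu k).2 n hk
      · simp
    have hmem : u n ∈ Φ.splitPiece n (n + 1) := by
      refine ⟨(hu n).1, fun j hj => ?_⟩
      rcases Nat.lt_succ_iff_lt_or_eq.1 hj with hj | hj
      · exact (hu n).2 j hj
      · rw [Fin.ext hj, hn]
    rwa [h.splitPiece_eq_bot (Nat.lt_succ_self _), Submodule.mem_bot] at hmem

theorem IsQRacah.linearMap_ext (h : Φ.IsQRacah q a b) {X Y : Module.End 𝕂 V}
    (hXY : ∀ n ≤ d, ∀ v ∈ Φ.splitPiece n n, X v = Y v) : X = Y := by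
  have key : (⊤ : Submodule 𝕂 V) ≤ LinearMap.ker (X - Y) := by
    rw [← h.iSup_splitPiece, iSup_le_iff]
    intro n v hv
    rw [LinearMap.mem_ker, LinearMap.sub_apply, sub_eq_zero]
    by_cases hn : n ≤ d
    · exact hXY n hn v hv
    · rw [Φ.splitPiece_eq_bot_of_lt (by omega), Submodule.mem_bot] at hv
      rw [hv, map_zero, map_zero]
  exact LinearMap.ext fun v => sub_eq_zero.1 (key (Submodule.mem_top (x := v)))

end TDSystem

/-! ### Linear maps prescribed on an independent family -/

theorem exists_end_of_independent {𝕂 V ι : Type*} [Field 𝕂] [AddCommGroup V] [Module 𝕂 V]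
    [Fintype ι] (M : ι → Submodule 𝕂 V) (f g : ∀ s, M s →ₗ[𝕂] V)
    (hf : ∀ x : (∀ s, M s), ∑ s, f s (x s) = 0 → ∀ s, x s = 0) :
    ∃ X : Module.End 𝕂 V, ∀ s (x : M s), X (f s x) = g s x := by
  classical
  have hker : LinearMap.ker (LinearMap.lsum 𝕂 (fun s => M s) 𝕂 f) = ⊥ := by
    refine LinearMap.ker_eq_bot'.2 fun x hx => funext (hf x ?_)
    simpa [LinearMap.lsum_apply] using hx
  obtain ⟨p, hp⟩ := LinearMap.exists_leftInverse_of_injective _ hker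
  refine ⟨(LinearMap.lsum 𝕂 (fun s => M s) 𝕂 g).comp p, fun s x => ?_⟩
  have h1 := LinearMap.congr_fun hp (Pi.single s x)
  rw [LinearMap.comp_apply, LinearMap.lsum_piSingle, LinearMap.id_apply] at h1
  rw [LinearMap.comp_apply, h1, LinearMap.lsum_piSingle]

namespace TDSystem

variable {𝕂 V : Type*} [Field 𝕂] [AddCommGroup V] [Module 𝕂 V] {d : ℕ}

/-! ### Inversions -/

section Inversions

variable (Φ : TDSystem 𝕂 V d) {q a b : 𝕂}

/-- The relative `(A'; E' d, …, E' 0; A; E d, …, E 0)` of `Φ`, whose split decomposition is that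
of `Φ` in reversed order. -/
def dualInversion : TDSystem 𝕂 V d where
  A := Φ.A'
  E := fun i => Φ.E' i.rev
  A' := Φ.A
  E' := fun i => Φ.E i.rev
  isTridiagonalPair :=
    { diagonalizable := Φ.isTridiagonalPair.diagonalizable'
      diagonalizable' := Φ.isTridiagonalPair.diagonalizable
      exists_ordering := Φ.isTridiagonalPair.exists_ordering'
      exists_ordering' := Φ.isTridiagonalPair.exists_ordering
      irreducible := fun ⟨W, h1, h2, h3⟩ =>
        Φ.isTridiagonalPair.irreducible ⟨W, h2, h1, h3⟩ }
  standard := Φ.standard'.rev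
  standard' := Φ.standard.rev

theorem splitPiece_dualInversion {i : ℕ} (hi : i ≤ d) :
    Φ.dualInversion.splitPiece i i = Φ.splitPiece (d - i) (d - i) := by
  ext v
  simp only [mem_splitPiece, dualInversion]
  constructor
  · rintro ⟨h1, h2⟩
    refine ⟨fun j hj => ?_, fun j hj => ?_⟩
    · rw [← Fin.rev_rev j]
      exact h2 _ (by rw [Fin.val_rev]; omega)
    · rw [← Fin.rev_rev j]
      exact h1 _ (by rw [Fin.val_rev]; omega)
  · rintro ⟨h1, h2⟩
    exact ⟨fun j hj => h2 _ (by rw [Fin.val_rev]; omega),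
      fun j hj => h1 _ (by rw [Fin.val_rev]; omega)⟩

theorem kSpace_secondInversion (i : ℕ) : Φ.secondInversion.kSpace i = Φ.kSpace i := by
  ext v
  simp only [mem_kSpace, mem_splitPiece, secondInversion]
  constructor
  · rintro ⟨⟨h1, h2⟩, h3⟩
    refine ⟨⟨h1, fun j hj => ?_⟩, fun j hj => ?_⟩
    · rw [← Fin.rev_rev j]
      exact h3 _ (by rw [Fin.val_rev]; omega)
    · rw [← Fin.rev_rev j]
      exact h2 _ (by rw [Fin.val_rev]; omega)
  · rintro ⟨⟨h1, h2⟩, h3⟩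
    exact ⟨⟨h1, fun j hj => h3 _ (by rw [Fin.val_rev]; omega)⟩,
      fun j hj => h2 _ (by rw [Fin.val_rev]; omega)⟩

theorem eigenvalue_rev (q a : 𝕂) (i : Fin (d + 1)) :
    a * q ^ ((d : ℤ) - 2 * ((i.rev : ℕ) : ℤ)) + a⁻¹ * q ^ (2 * ((i.rev : ℕ) : ℤ) - (d : ℤ)) =
      a⁻¹ * q ^ ((d : ℤ) - 2 * (i : ℤ)) + a⁻¹⁻¹ * q ^ (2 * (i : ℤ) - (d : ℤ)) := by
  have h : ((i.rev : ℕ) : ℤ) = d - i := by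
    rw [Fin.val_rev]
    omega
  rw [h, inv_inv, add_comm]
  congr 3 <;> ring

variable {Φ}

theorem IsQRacah.secondInversion (h : Φ.IsQRacah q a b) :
    Φ.secondInversion.IsQRacah q a⁻¹ b where
  q_ne_zero := h.q_ne_zero
  a_ne_zero := inv_ne_zero h.a_ne_zero
  b_ne_zero := h.b_ne_zero
  q_pow_four_ne_one := h.q_pow_four_ne_one
  eigenvalue := fun i v hv => by
    rw [← eigenvalue_rev]
    exact h.eigenvalue i.rev v hv
  eigenvalue' := h.eigenvalue'

theorem IsQRacah.dualInversion (h : Φ.IsQRacah q a b) :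
    Φ.dualInversion.IsQRacah q b⁻¹ a⁻¹ where
  q_ne_zero := h.q_ne_zero
  a_ne_zero := inv_ne_zero h.b_ne_zero
  b_ne_zero := inv_ne_zero h.a_ne_zero
  q_pow_four_ne_one := h.q_pow_four_ne_one
  eigenvalue := fun i v hv => by
    rw [← eigenvalue_rev]
    exact h.eigenvalue' i.rev v hv
  eigenvalue' := fun i v hv => by
    rw [← eigenvalue_rev]
    exact h.eigenvalue i.rev v hv

end Inversions

/-! ### The operator `K` and the raising map `R` -/

variable {Φ : TDSystem 𝕂 V d} {q a b : 𝕂} {K : (Module.End 𝕂 V)ˣ}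

theorem IsQRacah.exists_diagonal (h : Φ.IsQRacah q a b) (c : ℕ → 𝕂) :
    ∃ X : Module.End 𝕂 V, ∀ n ≤ d, ∀ v ∈ Φ.splitPiece n n, X v = c n • v := by
  obtain ⟨X, hX⟩ := exists_end_of_independent
    (fun n : Fin (d + 1) => Φ.splitPiece n n) (fun n => Submodule.subtype _)
    (fun n => c n • Submodule.subtype _) (fun x hx s =>
      Subtype.ext (h.eq_zero_of_sum_eq_zero (u := fun n => x n) (fun n => (x n).2) hx s))
  exact ⟨X, fun n hn v hv => hX ⟨n, Nat.lt_succ_of_le hn⟩ ⟨v, hv⟩⟩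

theorem IsK.apply {K : Module.End 𝕂 V} (hK : Φ.IsK q K) {n : ℕ} {v : V}
    (hv : v ∈ Φ.splitPiece n n) : K v = q ^ ((d : ℤ) - 2 * (n : ℤ)) • v := by
  by_cases hn : n ≤ d
  · exact hK ⟨n, Nat.lt_succ_of_le hn⟩ v (by rwa [U_eq_splitPiece])
  · rw [Φ.splitPiece_eq_bot_of_lt (by omega), Submodule.mem_bot] at hv
    rw [hv, map_zero, smul_zero]

theorem IsQRacah.existsUnique_isK (h : Φ.IsQRacah q a b) :
    ∃! K : (Module.End 𝕂 V)ˣ, Φ.IsK q K := by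
  have hq := h.q_ne_zero
  obtain ⟨X, hX⟩ := h.exists_diagonal fun n => q ^ ((d : ℤ) - 2 * (n : ℤ))
  obtain ⟨Y, hY⟩ := h.exists_diagonal fun n => (q ^ ((d : ℤ) - 2 * (n : ℤ)))⁻¹
  refine ⟨⟨X, Y, h.linearMap_ext fun n hn v hv => ?_, h.linearMap_ext fun n hn v hv => ?_⟩,
    fun i v hv => hX i (Nat.le_of_lt_succ i.2) v (by rwa [← U_eq_splitPiece]),
    fun K hK => Units.ext (h.linearMap_ext fun n hn v hv => ?_)⟩
  · rw [Module.End.mul_apply, hY n hn v hv, map_smul, hX n hn v hv, smul_smul,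
      inv_mul_cancel₀ (zpow_ne_zero _ hq), one_smul, Module.End.one_apply]
  · rw [Module.End.mul_apply, hX n hn v hv, map_smul, hY n hn v hv, smul_smul,
      mul_inv_cancel₀ (zpow_ne_zero _ hq), one_smul, Module.End.one_apply]
  · rw [IsK.apply hK hv]
    exact (hX n hn v hv).symm

theorem IsQRacah.inv_apply (h : Φ.IsQRacah q a b) (hK : Φ.IsK q K) {n : ℕ} {v : V}
    (hv : v ∈ Φ.splitPiece n n) :
    (↑K⁻¹ : Module.End 𝕂 V) v = q ^ (2 * (n : ℤ) - (d : ℤ)) • v := by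
  have h1 : (↑K⁻¹ : Module.End 𝕂 V) ((K : Module.End 𝕂 V) v) = v := by
    rw [← Module.End.mul_apply, Units.inv_mul, Module.End.one_apply]
  rw [IsK.apply hK hv, map_smul] at h1
  conv_rhs => rw [← h1]
  rw [smul_smul, ← zpow_add₀ h.q_ne_zero, sub_add_sub_cancel, sub_self, zpow_zero, one_smul]

theorem IsQRacah.R_apply (h : Φ.IsQRacah q a b) (hK : Φ.IsK q K) {n : ℕ} {v : V}
    (hv : v ∈ Φ.splitPiece n n) : Φ.R a K v = Φ.A v - racahEigenvalue d q a n • v := by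
  rw [R, LinearMap.sub_apply, LinearMap.sub_apply, LinearMap.smul_apply, LinearMap.smul_apply,
    IsK.apply hK hv, h.inv_apply hK hv, smul_smul, smul_smul, sub_sub, ← add_smul]
  rfl

theorem IsQRacah.R_mem (h : Φ.IsQRacah q a b) (hK : Φ.IsK q K) {n : ℕ} {v : V}
    (hv : v ∈ Φ.splitPiece n n) : Φ.R a K v ∈ Φ.splitPiece (n + 1) (n + 1) := by
  rw [h.R_apply hK hv]
  exact h.A_sub_mem hv

theorem IsQRacah.R_pow_mem (h : Φ.IsQRacah q a b) (hK : Φ.IsK q K) {n : ℕ} {v : V}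
    (hv : v ∈ Φ.splitPiece n n) (m : ℕ) :
    (Φ.R a K ^ m) v ∈ Φ.splitPiece (n + m) (n + m) := by
  induction m with
  | zero => simpa using hv
  | succ m ih =>
    rw [pow_succ', Module.End.mul_apply]
    exact h.R_mem hK ih

theorem IsQRacah.E_R_pow (h : Φ.IsQRacah q a b) (hK : Φ.IsK q K) {n : ℕ} {v : V}
    (hv : v ∈ Φ.splitPiece n n) (m : ℕ) (j : Fin (d + 1)) :
    Φ.E j ((Φ.R a K ^ m) v) = (∏ l ∈ Finset.range m,
      (racahEigenvalue d q a j - racahEigenvalue d q a (n + l))) • Φ.E j v := by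
  induction m with
  | zero => simp
  | succ m ih =>
    rw [pow_succ', Module.End.mul_apply, h.R_apply hK (h.R_pow_mem hK hv m), map_sub, map_smul,
      h.E_A, ← sub_smul, ih, smul_smul, Finset.prod_range_succ, mul_comm]

theorem IsQRacah.E_eq_zero_of_R_pow (h : Φ.IsQRacah q a b) (hK : Φ.IsK q K) {n m : ℕ} {v : V}
    (hv : v ∈ Φ.splitPiece n n) (hm : (Φ.R a K ^ m) v = 0) {j : Fin (d + 1)}
    (hj : n + m ≤ j) : Φ.E j v = 0 := by
  have h1 := h.E_R_pow hK hv m j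
  rw [hm, map_zero, eq_comm, smul_eq_zero] at h1
  refine h1.resolve_left (Finset.prod_ne_zero_iff.2 fun l hl heq => ?_)
  have hj' := j.isLt
  rw [Finset.mem_range] at hl
  have := h.racahEigenvalue_injOn (by omega) (by omega) (sub_eq_zero.1 heq)
  omega

/-- Powers of the raising map are injective up to the opposite degree: their kernel lies in a
vanishing piece of the second split decomposition. -/
theorem IsQRacah.eq_zero_of_R_pow (h : Φ.IsQRacah q a b) (hK : Φ.IsK q K) {n m : ℕ}
    (hnm : 2 * n + m ≤ d) {v : V} (hv : v ∈ Φ.splitPiece n n) (hm : (Φ.R a K ^ m) v = 0) :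
    v = 0 := by
  have hmem : v ∈ Φ.secondInversion.splitPiece n (n + 1) := by
    refine ⟨hv.1, fun j hj => h.E_eq_zero_of_R_pow hK hv hm ?_⟩
    rw [Fin.val_rev]
    omega
  rwa [h.secondInversion.splitPiece_eq_bot (Nat.lt_succ_self n), Submodule.mem_bot] at hmem

theorem IsQRacah.mem_kSpace_iff (h : Φ.IsQRacah q a b) (hK : Φ.IsK q K) {i : ℕ}
    (hi : 2 * i ≤ d) {v : V} : v ∈ Φ.kSpace i ↔
      v ∈ Φ.splitPiece i i ∧ (Φ.R a K ^ (d - 2 * i + 1)) v = 0 := by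
  rw [mem_kSpace]
  refine and_congr_right fun hv => ⟨fun h1 => ?_, fun h1 j hj => ?_⟩
  · refine Φ.standard.eq_zero_of_forall Φ.isTridiagonalPair.diagonalizable fun j => ?_
    rw [h.E_R_pow hK hv]
    by_cases hj : d < (j : ℕ) + i
    · rw [h1 j hj, smul_zero]
    by_cases hj' : (j : ℕ) < i
    · rw [hv.2 j hj', smul_zero]
    · rw [Finset.prod_eq_zero (i := (j : ℕ) - i), zero_smul]
      · rw [Finset.mem_range]
        omega
      · rw [Nat.add_sub_cancel' (not_lt.1 hj'), sub_self]
  · exact h.E_eq_zero_of_R_pow hK hv h1 (by omega)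

theorem IsQRacah.R_pow_eq_zero (h : Φ.IsQRacah q a b) (hK : Φ.IsK q K) {i m : ℕ}
    (hi : 2 * i ≤ d) (hm : d < 2 * i + m) {v : V} (hv : v ∈ Φ.kSpace i) :
    (Φ.R a K ^ m) v = 0 := by
  have h1 := ((h.mem_kSpace_iff hK hi).1 hv).2
  obtain ⟨t, rfl⟩ : ∃ t, m = t + (d - 2 * i + 1) := ⟨m - (d - 2 * i + 1), by omega⟩
  rw [pow_add, Module.End.mul_apply, h1, map_zero]

section FiniteDimensional

variable [FiniteDimensional 𝕂 V]

theorem IsQRacah.finrank_splitPiece_le (h : Φ.IsQRacah q a b) {n : ℕ} (hn : 2 * n ≤ d) :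
    Module.finrank 𝕂 (Φ.splitPiece n n) ≤
      Module.finrank 𝕂 (Φ.splitPiece (d - n) (d - n)) := by
  obtain ⟨K, hK, -⟩ := h.existsUnique_isK
  have hmaps : ∀ v ∈ Φ.splitPiece n n,
      (Φ.R a K ^ (d - 2 * n)) v ∈ Φ.splitPiece (d - n) (d - n) := fun v hv => by
    have := h.R_pow_mem hK hv (d - 2 * n)
    rwa [show n + (d - 2 * n) = d - n by omega] at this
  refine LinearMap.finrank_le_finrank_of_injective
    (f := (Φ.R a K ^ (d - 2 * n)).restrict hmaps) ?_
  rw [← LinearMap.ker_eq_bot, LinearMap.ker_eq_bot']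
  intro v hv
  exact Subtype.ext (h.eq_zero_of_R_pow hK (by omega) v.2 (congrArg Subtype.val hv))

/-- The raising map satisfies the hard Lefschetz property. Surjectivity holds because the
dual inversion provides the opposite inequality of dimensions. -/
theorem IsQRacah.exists_R_pow_eq (h : Φ.IsQRacah q a b) (hK : Φ.IsK q K) {n : ℕ}
    (hn : 2 * n ≤ d) {w : V} (hw : w ∈ Φ.splitPiece (d - n) (d - n)) :
    ∃ v ∈ Φ.splitPiece n n, (Φ.R a K ^ (d - 2 * n)) v = w := by
  have hmaps : ∀ v ∈ Φ.splitPiece n n,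
      (Φ.R a K ^ (d - 2 * n)) v ∈ Φ.splitPiece (d - n) (d - n) := fun v hv => by
    have := h.R_pow_mem hK hv (d - 2 * n)
    rwa [show n + (d - 2 * n) = d - n by omega] at this
  have hrank := h.dualInversion.finrank_splitPiece_le hn
  rw [splitPiece_dualInversion Φ (by omega : n ≤ d),
    splitPiece_dualInversion Φ (Nat.sub_le d n), Nat.sub_sub_self (by omega)] at hrank
  have hinj : Function.Injective ((Φ.R a K ^ (d - 2 * n)).restrict hmaps) := by
    rw [← LinearMap.ker_eq_bot, LinearMap.ker_eq_bot']
    intro v hv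
    exact Subtype.ext (h.eq_zero_of_R_pow hK (by omega) v.2 (congrArg Subtype.val hv))
  obtain ⟨v, hv⟩ := (LinearMap.injective_iff_surjective_of_finrank_eq_finrank
    (le_antisymm (h.finrank_splitPiece_le hn) hrank)).1 hinj ⟨w, hw⟩
  exact ⟨v, v.2, congrArg Subtype.val hv⟩

/-- The Lefschetz decomposition as an induction principle: the primitive spaces `kSpace i`
generate `V` under the raising map. -/
theorem IsQRacah.eq_top_of_kSpace_le (h : Φ.IsQRacah q a b) (hK : Φ.IsK q K)
    {N : Submodule 𝕂 V} (hN : ∀ i, 2 * i ≤ d → Φ.kSpace i ≤ N)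
    (hR : ∀ n, ∀ v ∈ Φ.splitPiece n n, v ∈ N → Φ.R a K v ∈ N) : N = ⊤ := by
  have hpow : ∀ n m, ∀ v ∈ Φ.splitPiece n n, v ∈ N → (Φ.R a K ^ m) v ∈ N := by
    intro n m v hv hvN
    induction m with
    | zero => simpa using hvN
    | succ m ih =>
      rw [pow_succ', Module.End.mul_apply]
      exact hR _ _ (h.R_pow_mem hK hv m) ih
  have hlow : ∀ n, 2 * n ≤ d → Φ.splitPiece n n ≤ N := by
    intro n
    induction n with
    | zero =>
      intro _ v hv
      refine hN 0 (by omega) ((h.mem_kSpace_iff hK (by omega)).2 ⟨hv, ?_⟩)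
      have := h.R_pow_mem hK hv (d - 2 * 0 + 1)
      rwa [Φ.splitPiece_eq_bot_of_lt (by omega), Submodule.mem_bot] at this
    | succ n ih =>
      intro hn v hv
      have hmem := h.R_pow_mem hK hv (d - 2 * (n + 1) + 1)
      rw [show n + 1 + (d - 2 * (n + 1) + 1) = d - n by omega] at hmem
      obtain ⟨w, hw, hwv⟩ := h.exists_R_pow_eq hK (by omega : 2 * n ≤ d) hmem
      rw [show d - 2 * n = d - 2 * (n + 1) + 1 + 1 by omega, pow_succ, Module.End.mul_apply]
        at hwv
      have hRw := h.R_mem hK hw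
      have hk : v - Φ.R a K w ∈ Φ.kSpace (n + 1) :=
        (h.mem_kSpace_iff hK hn).2 ⟨Submodule.sub_mem _ hv hRw, by rw [map_sub, hwv, sub_self]⟩
      have := Submodule.add_mem _ (hN _ hn hk) (hR n w hw (ih (by omega) hw))
      rwa [sub_add_cancel] at this
  rw [eq_top_iff, ← h.iSup_splitPiece, iSup_le_iff]
  intro n
  by_cases hn : d < n
  · rw [Φ.splitPiece_eq_bot_of_lt hn]
    exact bot_le
  by_cases hn' : 2 * n ≤ d
  · exact hlow n hn'
  · intro v hv
    have hn2 : 2 * (d - n) ≤ d := by omega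
    obtain ⟨w, hw, rfl⟩ := h.exists_R_pow_eq hK hn2 (w := v)
      (by rwa [Nat.sub_sub_self (by omega)])
    exact hpow _ _ w hw (hlow _ hn2 hw)

end FiniteDimensional

/-! ### The double lowering operator -/

/-- The subspaces `R^(j-i) (kSpace i)` with `i ≤ j ≤ d - i` are independent. -/
theorem IsQRacah.eq_zero_of_sum_R_pow (h : Φ.IsQRacah q a b) (hK : Φ.IsK q K)
    (x : ∀ p : {p : Fin (d + 1) × Fin (d + 1) // p.1 ≤ p.2 ∧ (p.1 : ℕ) + p.2 ≤ d},
      Φ.kSpace p.1.1)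
    (hx : ∑ p, (Φ.R a K ^ ((p.1.2 : ℕ) - p.1.1)) (x p : V) = 0) (p) : x p = 0 := by
  classical
  have hmem : ∀ p, (x p : V) ∈ Φ.splitPiece p.1.1 p.1.1 := fun p =>
    ((Φ.mem_kSpace).1 (x p).2).1
  have hfib : ∀ j : Fin (d + 1), ∑ p with p.1.2 = j,
      (Φ.R a K ^ ((p.1.2 : ℕ) - p.1.1)) (x p : V) = 0 := by
    refine h.eq_zero_of_sum_eq_zero (fun j => Submodule.sum_mem _ fun p hp => ?_) ?_
    · obtain rfl := (Finset.mem_filter.1 hp).2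
      have := h.R_pow_mem hK (hmem p) ((p.1.2 : ℕ) - p.1.1)
      rwa [Nat.add_sub_cancel' (Fin.le_def.1 p.2.1)] at this
    · rw [Finset.sum_fiberwise, hx]
  have key : ∀ n, ∀ p, (p.1.1 : ℕ) = n → x p = 0 := by
    intro n
    induction n using Nat.strong_induction_on with
    | _ n ih =>
      intro p hp
      have hp2 := p.2.2
      have hp1 := Fin.le_def.1 p.2.1
      -- this power of `R` kills the terms with larger first index
      have h1 := congrArg (Φ.R a K ^ (d - p.1.1 - p.1.2)) (hfib p.1.2)
      rw [map_zero, map_sum, Finset.sum_eq_single p] at h1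
      · rw [← Module.End.mul_apply, ← pow_add] at h1
        exact Subtype.ext (h.eq_zero_of_R_pow hK (by omega) (hmem p) h1)
      · intro p' hp' hne
        have hj := (Finset.mem_filter.1 hp').2
        have hp2' := p'.2.2
        have hp1' := Fin.le_def.1 p'.2.1
        have hj' : (p'.1.2 : ℕ) = p.1.2 := congrArg Fin.val hj
        rw [← Module.End.mul_apply, ← pow_add]
        rcases lt_trichotomy (p'.1.1 : ℕ) p.1.1 with hlt | heq | hgt
        · rw [ih _ (hp ▸ hlt) p' rfl, Submodule.coe_zero, map_zero]
        · exact absurd (Subtype.ext (Prod.ext (Fin.ext heq) hj)) hne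
        · exact h.R_pow_eq_zero hK (by omega) (by omega) (x p').2
      · simp
  exact key _ p rfl

end TDSystem

/-! ### Relations for `U_q(sl_2)` operators -/

/-- The relations satisfied by a lowering operator `P`, a raising operator `R` and a weight
operator `k` with inverse `k'`: those of `U_q(sl_2)` with `e, f` rescaled by `q - q⁻¹`. -/
structure IsUqTriple {𝕂 Y : Type*} [Field 𝕂] [Ring Y] [Algebra 𝕂 Y] (q : 𝕂)
    (P R k k' : Y) : Prop where
  k_mul_k' : k * k' = 1
  k'_mul_k : k' * k = 1
  k_mul_P : k * P = q ^ 2 • (P * k)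
  k_mul_R : k * R = (q ^ 2)⁻¹ • (R * k)
  P_mul_R : P * R = R * P + (q - q⁻¹) • (k - k')

namespace IsUqTriple

variable {𝕂 Y : Type*} [Field 𝕂] [Ring Y] [Algebra 𝕂 Y] {q : 𝕂} {P R k k' : Y}

theorem k'_mul_P (h : IsUqTriple q P R k k') (hq : q ≠ 0) :
    k' * P = (q ^ 2)⁻¹ • (P * k') := by
  have h1 : k' * (k * P) * k' = k' * (q ^ 2 • (P * k)) * k' := by rw [h.k_mul_P]
  rw [← mul_assoc, h.k'_mul_k, one_mul, mul_smul_comm, smul_mul_assoc, mul_assoc, mul_assoc,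
    h.k_mul_k', mul_one] at h1
  rw [h1, smul_smul, inv_mul_cancel₀ (pow_ne_zero _ hq), one_smul]

theorem k'_mul_R (h : IsUqTriple q P R k k') (hq : q ≠ 0) :
    k' * R = q ^ 2 • (R * k') := by
  have h1 : k' * (k * R) * k' = k' * ((q ^ 2)⁻¹ • (R * k)) * k' := by rw [h.k_mul_R]
  rw [← mul_assoc, h.k'_mul_k, one_mul, mul_smul_comm, smul_mul_assoc, mul_assoc, mul_assoc,
    h.k_mul_k', mul_one] at h1
  rw [h1, smul_smul, mul_inv_cancel₀ (pow_ne_zero _ hq), one_smul]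

/-- The Casimir element commutes with `R + a k + a⁻¹ k'`. -/
theorem casimir_comm (h : IsUqTriple q P R k k') (hq : q ≠ 0) (a : 𝕂) :
    (P * R + q⁻¹ • k + q • k') * (R + a • k + a⁻¹ • k') =
      (R + a • k + a⁻¹ • k') * (P * R + q⁻¹ • k + q • k') := by
  have e2 := h.k'_mul_R hq
  have f2 : ∀ z, k * (R * z) = (q ^ 2)⁻¹ • (R * (k * z)) := fun z => by
    rw [← mul_assoc, h.k_mul_R, smul_mul_assoc, mul_assoc]
  have f4 : ∀ z, k' * (R * z) = q ^ 2 • (R * (k' * z)) := fun z => by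
    rw [← mul_assoc, e2, smul_mul_assoc, mul_assoc]
  simp only [mul_add, add_mul, mul_sub, sub_mul, smul_mul_assoc, mul_smul_comm, mul_assoc,
    f2, f4, h.k_mul_P, h.k_mul_R, h.k'_mul_P hq, e2, h.P_mul_R, h.k_mul_k', h.k'_mul_k]
  match_scalars <;> field_simp <;> ring

/-- An Askey–Wilson relation between `P` and `R + a k + a⁻¹ k'`. The point is that its
coefficients are invariant under the exchange of `a` and `a⁻¹`. -/
theorem askeyWilson (h : IsUqTriple q P R k k') (hq : q ≠ 0) {a : 𝕂} (ha : a ≠ 0) {A C : Y}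
    (hA : A = R + a • k + a⁻¹ • k') (hC : C = P * R + q⁻¹ • k + q • k') :
    P * (A * A) = (q ^ 2 + (q ^ 2)⁻¹) • (A * (P * A)) - A * (A * P)
      - (q ^ 2 - (q ^ 2)⁻¹) ^ 2 • P - (q - q⁻¹) ^ 2 • (A * C)
      + ((a + a⁻¹) * ((q - q⁻¹) ^ 2 * (q + q⁻¹))) • (1 : Y) := by
  have e1 := h.k'_mul_P hq
  have e2 := h.k'_mul_R hq
  have f1 : ∀ z, k * (P * z) = q ^ 2 • (P * (k * z)) := fun z => by
    rw [← mul_assoc, h.k_mul_P, smul_mul_assoc, mul_assoc]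
  have f2 : ∀ z, k * (R * z) = (q ^ 2)⁻¹ • (R * (k * z)) := fun z => by
    rw [← mul_assoc, h.k_mul_R, smul_mul_assoc, mul_assoc]
  have f3 : ∀ z, k' * (P * z) = (q ^ 2)⁻¹ • (P * (k' * z)) := fun z => by
    rw [← mul_assoc, e1, smul_mul_assoc, mul_assoc]
  have f4 : ∀ z, k' * (R * z) = q ^ 2 • (R * (k' * z)) := fun z => by
    rw [← mul_assoc, e2, smul_mul_assoc, mul_assoc]
  have f5 : ∀ z, P * (R * z) = R * (P * z) + (q - q⁻¹) • (k * z - k' * z) := fun z => by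
    rw [← mul_assoc, h.P_mul_R, add_mul, smul_mul_assoc, sub_mul, mul_assoc]
  subst hA hC
  simp only [mul_add, add_mul, mul_sub, smul_mul_assoc, mul_smul_comm, mul_one,
    f1, f2, f3, f4, f5, h.k_mul_P, h.k_mul_R, e1, e2, h.P_mul_R, h.k_mul_k', h.k'_mul_k]
  match_scalars <;> field_simp <;> ring

end IsUqTriple

namespace TDSystem

variable {𝕂 V : Type*} [Field 𝕂] [AddCommGroup V] [Module 𝕂 V] {d : ℕ}
  {Φ : TDSystem 𝕂 V d} {q a b : 𝕂} {K : (Module.End 𝕂 V)ˣ}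

theorem IsQRacah.sub_inv_ne_zero (h : Φ.IsQRacah q a b) : q - q⁻¹ ≠ 0 := by
  intro h0
  have hq := h.q_ne_zero
  have h1 : q * q = 1 := by
    calc q * q = q * q⁻¹ := by rw [← sub_eq_zero.1 h0]
      _ = 1 := mul_inv_cancel₀ hq
  exact h.q_pow_four_ne_one (by linear_combination (q * q + 1) * h1)

theorem IsQRacah.psi_A_apply (h : Φ.IsQRacah q a b) (hK : Φ.IsK q K) {ψ : Module.End 𝕂 V}
    (hψ : Φ.IsPsi q a K ψ) {i : ℕ} (hi : 2 * i ≤ d) {v : V} (hv : v ∈ Φ.kSpace i) :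
    ψ (Φ.A v) = ((q - q⁻¹) * (q ^ ((d : ℤ) - 2 * (i : ℤ)) - q ^ (2 * (i : ℤ) - (d : ℤ)))) • v := by
  have hv' := ((Φ.mem_kSpace).1 hv).1
  have h1 := LinearMap.congr_fun hψ.1 v
  rw [LinearMap.sub_apply, Module.End.mul_apply, Module.End.mul_apply, hψ.2 i hi v hv, map_zero,
    sub_zero, h.R_apply hK hv', map_sub, map_smul, hψ.2 i hi v hv, smul_zero, sub_zero,
    LinearMap.smul_apply, LinearMap.sub_apply, IsK.apply hK hv', h.inv_apply hK hv', ← sub_smul,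
    smul_smul] at h1
  exact h1

theorem A_eq_R_add (Φ : TDSystem 𝕂 V d) (a : 𝕂) (K : (Module.End 𝕂 V)ˣ) :
    Φ.A = Φ.R a K + a • (K : Module.End 𝕂 V) + a⁻¹ • (↑K⁻¹ : Module.End 𝕂 V) := by
  rw [R]
  abel

variable [FiniteDimensional 𝕂 V]

/-- Two linear maps agree if they agree on all `R^m v` with `v` primitive of degree `i` and
`2 i + m ≤ d`. -/
theorem IsQRacah.linearMap_ext_R_pow (h : Φ.IsQRacah q a b) (hK : Φ.IsK q K)
    {X Y : Module.End 𝕂 V} (hXY : ∀ i m, 2 * i + m ≤ d → ∀ v ∈ Φ.kSpace i,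
      X ((Φ.R a K ^ m) v) = Y ((Φ.R a K ^ m) v)) : X = Y := by
  have htop := h.eq_top_of_kSpace_le hK
    (N := ⨆ i : ℕ, ⨆ _ : 2 * i ≤ d, ⨆ m : ℕ, (Φ.kSpace i).map (Φ.R a K ^ m)) ?_ ?_
  · have hle : ⨆ i : ℕ, ⨆ _ : 2 * i ≤ d, ⨆ m : ℕ, (Φ.kSpace i).map (Φ.R a K ^ m) ≤
        LinearMap.ker (X - Y) := by
      refine iSup₂_le fun i hi => iSup_le fun m => ?_
      rintro _ ⟨v, hv, rfl⟩
      rw [LinearMap.mem_ker, LinearMap.sub_apply, sub_eq_zero]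
      by_cases hm : 2 * i + m ≤ d
      · exact hXY i m hm v hv
      · rw [h.R_pow_eq_zero hK hi (not_le.1 hm) hv, map_zero, map_zero]
    rw [htop] at hle
    exact LinearMap.ext fun v => sub_eq_zero.1 (hle (Submodule.mem_top (x := v)))
  · intro i hi
    refine le_iSup₂_of_le i hi (le_iSup_of_le 0 ?_)
    rw [pow_zero, Module.End.one_eq_id, Submodule.map_id]
  · intro _ v _ hv
    have hle : (⨆ i : ℕ, ⨆ _ : 2 * i ≤ d, ⨆ m : ℕ, (Φ.kSpace i).map (Φ.R a K ^ m)).map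
        (Φ.R a K) ≤ ⨆ i : ℕ, ⨆ _ : 2 * i ≤ d, ⨆ m : ℕ, (Φ.kSpace i).map (Φ.R a K ^ m) := by
      simp only [Submodule.map_iSup]
      refine iSup₂_le fun i hi => iSup_le fun m => ?_
      refine le_iSup₂_of_le i hi (le_iSup_of_le (m + 1) ?_)
      rw [pow_succ', Module.End.mul_eq_comp, Submodule.map_comp]
    exact hle (Submodule.mem_map_of_mem hv)

theorem IsQRacah.existsUnique_isPsi (h : Φ.IsQRacah q a b) (hK : Φ.IsK q K) :
    ∃! ψ : Module.End 𝕂 V, Φ.IsPsi q a K ψ := by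
  have hq := h.q_ne_zero
  -- the coefficient of `ψ R^m v = c i m • R^(m-1) v`, forced by summing the commutators
  let c : ℕ → ℕ → 𝕂 := fun i m => (q ^ (m : ℤ) - q ^ (-(m : ℤ))) *
    (q ^ ((d : ℤ) - 2 * i - m + 1) - q ^ (-((d : ℤ) - 2 * i - m + 1)))
  have hc : ∀ i m : ℕ, c i (m + 1) - c i m =
      (q - q⁻¹) * (q ^ ((d : ℤ) - 2 * ((i + m : ℕ) : ℤ)) -
        q ^ (2 * ((i + m : ℕ) : ℤ) - (d : ℤ))) := by
    intro i m
    simp only [c]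
    generalize hD : (d : ℤ) - 2 * i = D
    rw [show (d : ℤ) - 2 * ((i + m : ℕ) : ℤ) = D - m - m by push_cast; linarith,
      show 2 * ((i + m : ℕ) : ℤ) - (d : ℤ) = m + m - D by push_cast; linarith]
    push_cast
    simp only [neg_add, neg_sub, zpow_add₀ hq, zpow_sub₀ hq, zpow_neg, zpow_one]
    have h1 : q ^ D ≠ 0 := zpow_ne_zero _ hq
    have h2 : q ^ (m : ℤ) ≠ 0 := zpow_ne_zero _ hq
    generalize q ^ D = x at *
    generalize q ^ (m : ℤ) = y at *
    field_simp
    ring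
  obtain ⟨ψ, hψ⟩ := exists_end_of_independent
    (fun p : {p : Fin (d + 1) × Fin (d + 1) // p.1 ≤ p.2 ∧ (p.1 : ℕ) + p.2 ≤ d} =>
      Φ.kSpace p.1.1)
    (fun p => (Φ.R a K ^ ((p.1.2 : ℕ) - p.1.1)).comp (Submodule.subtype _))
    (fun p => c p.1.1 ((p.1.2 : ℕ) - p.1.1) •
      (Φ.R a K ^ ((p.1.2 : ℕ) - p.1.1 - 1)).comp (Submodule.subtype _))
    (fun x hx => h.eq_zero_of_sum_R_pow hK x hx)
  have hψ' : ∀ i m, 2 * i + m ≤ d → ∀ v ∈ Φ.kSpace i,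
      ψ ((Φ.R a K ^ m) v) = c i m • (Φ.R a K ^ (m - 1)) v := by
    intro i m him v hv
    have := hψ ⟨(⟨i, by omega⟩, ⟨i + m, by omega⟩), Fin.le_def.2 (Nat.le_add_right _ _),
      show i + (i + m) ≤ d by omega⟩ ⟨v, hv⟩
    simpa using this
  -- the formula persists one step further, where both sides vanish
  have hψ'' : ∀ i m, 2 * i + m ≤ d → ∀ v ∈ Φ.kSpace i,
      ψ ((Φ.R a K ^ (m + 1)) v) = c i (m + 1) • (Φ.R a K ^ m) v := by
    intro i m him v hv
    rcases Nat.lt_or_eq_of_le him with hlt | heq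
    · exact hψ' i (m + 1) (by omega) v hv
    · have h0 : c i (m + 1) = 0 := by
        simp only [c]
        rw [show (d : ℤ) - 2 * i - (m + 1 : ℕ) + 1 = 0 by push_cast; omega, neg_zero, sub_self,
          mul_zero]
      rw [h.R_pow_eq_zero hK (by omega) (by omega) hv, map_zero, h0, zero_smul]
  have hc0 : ∀ i, c i 0 = 0 := fun i => by simp [c]
  have hψK : Φ.IsPsi q a K ψ := by
    refine ⟨h.linearMap_ext_R_pow hK fun i m him v hv => ?_, fun i hi v hv => ?_⟩
    · have hmem := h.R_pow_mem hK ((Φ.mem_kSpace).1 hv).1 m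
      have h2 : Φ.R a K (ψ ((Φ.R a K ^ m) v)) = c i m • (Φ.R a K ^ m) v := by
        rw [hψ' i m him v hv]
        rcases m with _ | m
        · simp [hc0]
        · rw [map_smul, Nat.add_sub_cancel, pow_succ', Module.End.mul_apply]
      rw [LinearMap.sub_apply, Module.End.mul_apply, Module.End.mul_apply, h2,
        ← Module.End.mul_apply (Φ.R a K), ← pow_succ', hψ'' i m him v hv, ← sub_smul, hc,
        LinearMap.smul_apply, LinearMap.sub_apply, IsK.apply hK hmem, h.inv_apply hK hmem,
        ← sub_smul, smul_smul]
    · have := hψ' i 0 (by omega) v hv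
      rwa [hc0, zero_smul, pow_zero, Module.End.one_apply] at this
  refine ⟨ψ, hψK, fun ψ₂ hψ₂ => ?_⟩
  have hker := h.eq_top_of_kSpace_le hK (N := LinearMap.ker (ψ₂ - ψ)) ?_ ?_
  · exact sub_eq_zero.1 (LinearMap.ker_eq_top.1 hker)
  · intro i hi v hv
    rw [LinearMap.mem_ker, LinearMap.sub_apply, hψ₂.2 i hi v hv, hψK.2 i hi v hv, sub_zero]
  · intro _ v _ hv
    have h1 := LinearMap.congr_fun (hψ₂.1.trans hψK.1.symm) v
    rw [LinearMap.mem_ker, LinearMap.sub_apply, sub_eq_zero] at hv ⊢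
    simp only [LinearMap.sub_apply, Module.End.mul_apply, hv] at h1
    exact sub_left_injective h1

/-- The operators `ψ`, `R`, `K` satisfy the relations of `U_q(sl_2)`. -/
theorem IsQRacah.isUqTriple (h : Φ.IsQRacah q a b) (hK : Φ.IsK q K) {ψ : Module.End 𝕂 V}
    (hψ : Φ.IsPsi q a K ψ) :
    IsUqTriple q ψ (Φ.R a K) (K : Module.End 𝕂 V) (↑K⁻¹ : Module.End 𝕂 V) := by
  have hq := h.q_ne_zero
  have hKR : (K : Module.End 𝕂 V) * Φ.R a K = (q ^ 2)⁻¹ • (Φ.R a K * K) := by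
    refine h.linearMap_ext fun n _ v hv => ?_
    rw [LinearMap.smul_apply, Module.End.mul_apply, Module.End.mul_apply,
      IsK.apply hK (h.R_mem hK hv), IsK.apply hK hv, map_smul, smul_smul,
      show (d : ℤ) - 2 * ((n + 1 : ℕ) : ℤ) = -((2 : ℕ) : ℤ) + (d - 2 * n) by push_cast; ring,
      zpow_add₀ hq, zpow_neg, zpow_natCast]
  have hPR : ψ * Φ.R a K = Φ.R a K * ψ +
      (q - q⁻¹) • ((K : Module.End 𝕂 V) - (↑K⁻¹ : Module.End 𝕂 V)) := by
    rw [← hψ.1, add_sub_cancel]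
  refine ⟨K.mul_inv, K.inv_mul, ?_, hKR, hPR⟩
  -- the kernel of `K ψ - q² ψ K` contains the primitive vectors and is stable under `R`
  have hker := h.eq_top_of_kSpace_le hK
    (N := LinearMap.ker ((K : Module.End 𝕂 V) * ψ - q ^ 2 • (ψ * (K : Module.End 𝕂 V)))) ?_ ?_
  · exact sub_eq_zero.1 (LinearMap.ker_eq_top.1 hker)
  · intro i hi v hv
    rw [LinearMap.mem_ker, LinearMap.sub_apply, LinearMap.smul_apply, Module.End.mul_apply,
      Module.End.mul_apply, IsK.apply hK ((Φ.mem_kSpace).1 hv).1, map_smul, hψ.2 i hi v hv,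
      map_zero, smul_zero, smul_zero, sub_zero]
  · intro _ v _ hv
    have hcomm : ((K : Module.End 𝕂 V) * ψ - q ^ 2 • (ψ * (K : Module.End 𝕂 V))) * Φ.R a K =
        (q ^ 2)⁻¹ • (Φ.R a K *
          ((K : Module.End 𝕂 V) * ψ - q ^ 2 • (ψ * (K : Module.End 𝕂 V)))) := by
      rw [sub_mul, mul_assoc, hPR, smul_mul_assoc, mul_assoc, hKR, mul_smul_comm, ← mul_assoc,
        hPR, mul_add, ← mul_assoc, hKR]
      simp only [add_mul, mul_sub, sub_mul, smul_mul_assoc, mul_smul_comm, mul_assoc,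
        Units.mul_inv, Units.inv_mul]
      match_scalars <;> field_simp <;> ring
    rw [LinearMap.mem_ker] at hv ⊢
    rw [← Module.End.mul_apply, hcomm, LinearMap.smul_apply, Module.End.mul_apply, hv, map_zero,
      smul_zero]

/-- The element `ψ R + q⁻¹ K + q K⁻¹` acts on the primitive vectors of degree `i` as a scalar
that does not depend on `a`. -/
theorem IsQRacah.casimir_apply (h : Φ.IsQRacah q a b) (hK : Φ.IsK q K) {ψ : Module.End 𝕂 V}
    (hψ : Φ.IsPsi q a K ψ) {i : ℕ} (hi : 2 * i ≤ d) {v : V} (hv : v ∈ Φ.kSpace i) :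
    (ψ * Φ.R a K + q⁻¹ • (K : Module.End 𝕂 V) + q • (↑K⁻¹ : Module.End 𝕂 V)) v =
      (q * q ^ ((d : ℤ) - 2 * (i : ℤ)) + q⁻¹ * q ^ (2 * (i : ℤ) - (d : ℤ))) • v := by
  have hv' := ((Φ.mem_kSpace).1 hv).1
  rw [(h.isUqTriple hK hψ).P_mul_R]
  simp only [LinearMap.add_apply, LinearMap.smul_apply, LinearMap.sub_apply,
    Module.End.mul_apply, hψ.2 i hi v hv, map_zero, zero_add, IsK.apply hK hv',
    h.inv_apply hK hv']
  module

/-- The operator `ψ` and the Casimir element are the same for `Φ` and its second inversion: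
the two versions agree on primitive vectors, and the relations that propagate them along powers
of `A` are symmetric under `a ↔ a⁻¹`. -/
theorem IsQRacah.psi_eq_and_casimir_eq (h : Φ.IsQRacah q a b) (hK : Φ.IsK q K)
    {ψ ψ₂ : Module.End 𝕂 V} (hψ : Φ.IsPsi q a K ψ) {B : (Module.End 𝕂 V)ˣ}
    (hB : Φ.secondInversion.IsK q B) (hψ₂ : Φ.secondInversion.IsPsi q a⁻¹ B ψ₂) :
    ψ = ψ₂ ∧ ψ * Φ.R a K + q⁻¹ • (K : Module.End 𝕂 V) + q • (↑K⁻¹ : Module.End 𝕂 V) =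
      ψ₂ * Φ.secondInversion.R a⁻¹ B + q⁻¹ • (B : Module.End 𝕂 V) +
        q • (↑B⁻¹ : Module.End 𝕂 V) := by
  have hq := h.q_ne_zero
  have h₂ := h.secondInversion
  have hA := A_eq_R_add Φ a K
  have hA₂ : Φ.A = _ := A_eq_R_add Φ.secondInversion a⁻¹ B
  have hT := h.isUqTriple hK hψ
  have hT₂ := h₂.isUqTriple hB hψ₂
  obtain ⟨C, hC⟩ : ∃ C, C = ψ * Φ.R a K + q⁻¹ • (K : Module.End 𝕂 V) +
    q • (↑K⁻¹ : Module.End 𝕂 V) := ⟨_, rfl⟩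
  obtain ⟨C₂, hC₂⟩ : ∃ C₂, C₂ = ψ₂ * Φ.secondInversion.R a⁻¹ B +
    q⁻¹ • (B : Module.End 𝕂 V) + q • (↑B⁻¹ : Module.End 𝕂 V) := ⟨_, rfl⟩
  have hCA : C * Φ.A = Φ.A * C := by
    rw [hC, hA]
    exact hT.casimir_comm hq a
  have hCA₂ : C₂ * Φ.A = Φ.A * C₂ := by
    rw [hC₂, hA₂]
    exact hT₂.casimir_comm hq a⁻¹
  have hAW := hT.askeyWilson hq h.a_ne_zero hA hC
  have hAW₂ := hT₂.askeyWilson hq h₂.a_ne_zero hA₂ hC₂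
  rw [inv_inv, add_comm a⁻¹ a] at hAW₂
  have hker := h.eq_top_of_kSpace_le hK (N := LinearMap.ker (ψ - ψ₂) ⊓
    LinearMap.ker ((ψ - ψ₂) * Φ.A) ⊓ LinearMap.ker (C - C₂)) ?_ ?_
  · rw [inf_eq_top_iff, inf_eq_top_iff] at hker
    rw [← hC, ← hC₂]
    exact ⟨sub_eq_zero.1 (LinearMap.ker_eq_top.1 hker.1.1),
      sub_eq_zero.1 (LinearMap.ker_eq_top.1 hker.2)⟩
  · intro i hi v hv
    have hv₂ : v ∈ Φ.secondInversion.kSpace i := by rwa [kSpace_secondInversion]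
    refine ⟨⟨?_, ?_⟩, ?_⟩ <;> rw [SetLike.mem_coe, LinearMap.mem_ker]
    · rw [LinearMap.sub_apply, hψ.2 i hi v hv, hψ₂.2 i hi v hv₂, sub_zero]
    · rw [Module.End.mul_apply, LinearMap.sub_apply, h.psi_A_apply hK hψ hi hv, sub_eq_zero]
      exact (h₂.psi_A_apply hB hψ₂ hi hv₂).symm
    · rw [LinearMap.sub_apply, hC, hC₂, h.casimir_apply hK hψ hi hv,
        h₂.casimir_apply hB hψ₂ hi hv₂, sub_self]
  · rintro n v hv hvN
    suffices hAv : Φ.A v ∈ LinearMap.ker (ψ - ψ₂) ⊓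
        LinearMap.ker ((ψ - ψ₂) * Φ.A) ⊓ LinearMap.ker (C - C₂) by
      rw [h.R_apply hK hv]
      exact Submodule.sub_mem _ hAv (Submodule.smul_mem _ _ hvN)
    obtain ⟨⟨h1, h2⟩, h3⟩ := hvN
    rw [SetLike.mem_coe, LinearMap.mem_ker, LinearMap.sub_apply, sub_eq_zero] at h1 h3
    rw [SetLike.mem_coe, LinearMap.mem_ker, Module.End.mul_apply, LinearMap.sub_apply,
      sub_eq_zero] at h2
    refine ⟨⟨?_, ?_⟩, ?_⟩ <;> rw [SetLike.mem_coe, LinearMap.mem_ker]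
    · rw [LinearMap.sub_apply, h2, sub_self]
    · have e1 := LinearMap.congr_fun hAW v
      have e2 := LinearMap.congr_fun hAW₂ v
      simp only [LinearMap.add_apply, LinearMap.sub_apply, LinearMap.smul_apply,
        Module.End.mul_apply, h1, h2, h3] at e1 e2
      rw [Module.End.mul_apply, LinearMap.sub_apply, e1, e2, sub_self]
    · rw [LinearMap.sub_apply, ← Module.End.mul_apply, ← Module.End.mul_apply, hCA, hCA₂,
        Module.End.mul_apply, Module.End.mul_apply, h3, sub_self]

end TDSystem

/-! ### Representations of `U_q(sl_2)` -/

namespace Uq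

variable {𝕂 V : Type*} [Field 𝕂] [AddCommGroup V] [Module 𝕂 V] {q : 𝕂}
  {ψ R : Module.End 𝕂 V} {K : (Module.End 𝕂 V)ˣ}

theorem existsUnique_actsBy (hq : q - q⁻¹ ≠ 0)
    (h : IsUqTriple q ψ R (K : Module.End 𝕂 V) (↑K⁻¹ : Module.End 𝕂 V)) :
    ∃! ρ : Uq q →ₐ[𝕂] Module.End 𝕂 V, ActsBy q ρ ψ R K := by
  let g : UqGen → Module.End 𝕂 V
    | UqGen.e => (q - q⁻¹)⁻¹ • ψ
    | UqGen.f => (q - q⁻¹)⁻¹ • R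
    | UqGen.k => K
    | UqGen.kinv => (↑K⁻¹ : Module.End 𝕂 V)
  have hg : ∀ ⦃x y : FreeAlgebra 𝕂 UqGen⦄, UqRel q x y →
      FreeAlgebra.lift 𝕂 g x = FreeAlgebra.lift 𝕂 g y := by
    intro x y hxy
    cases hxy with
    | k_mul_kinv => simp [g]
    | kinv_mul_k => simp [g]
    | k_e =>
      simp only [map_mul, map_smul, FreeAlgebra.lift_ι_apply, g, mul_smul_comm, smul_mul_assoc]
      rw [h.k_mul_P, smul_mul_assoc, mul_assoc, h.k_mul_k', mul_one, smul_comm]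
    | k_f =>
      simp only [map_mul, map_smul, FreeAlgebra.lift_ι_apply, g, mul_smul_comm, smul_mul_assoc]
      rw [h.k_mul_R, smul_mul_assoc, mul_assoc, h.k_mul_k', mul_one, smul_comm]
    | e_f =>
      simp only [map_mul, map_smul, map_sub, FreeAlgebra.lift_ι_apply, g, mul_smul_comm,
        smul_mul_assoc, h.P_mul_R]
      rw [← smul_sub, ← smul_sub, add_sub_cancel_left, smul_smul, smul_smul,
        mul_assoc, inv_mul_cancel₀ hq, mul_one]
  refine ⟨RingQuot.liftAlgHom 𝕂 ⟨FreeAlgebra.lift 𝕂 g, hg⟩, ⟨?_, ?_, ?_, ?_⟩, ?_⟩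
  · simp [gen, g]
  · simp [gen, g]
  · simp [gen, g]
  · simp [gen, g]
  · intro ρ hρ
    refine RingQuot.ringQuot_ext' _ _ _ (FreeAlgebra.hom_ext (funext fun x => ?_))
    have : ρ (gen q x) = g x := by
      cases x
      · exact hρ.e
      · exact hρ.f
      · exact hρ.k
      · exact hρ.kinv
    simpa [gen] using this

theorem ActsBy.casimir_eq (hq : q - q⁻¹ ≠ 0) {ρ : Uq q →ₐ[𝕂] Module.End 𝕂 V}
    (h : ActsBy q ρ ψ R K) : ρ (casimir q) =
      ψ * R + q⁻¹ • (K : Module.End 𝕂 V) + q • (↑K⁻¹ : Module.End 𝕂 V) := by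
  have hs : (q - q⁻¹) ^ 2 * ((q - q⁻¹)⁻¹ * (q - q⁻¹)⁻¹) = 1 := by
    rw [← mul_inv, ← sq, mul_inv_cancel₀ (pow_ne_zero 2 hq)]
  rw [casimir, map_add, map_add, map_smul, map_smul, map_smul, map_mul, h.e, h.f, h.k, h.kinv,
    smul_mul_smul_comm, smul_smul, hs, one_smul]

end Uq

theorem lemma9p1 {𝕂 V : Type*} [Field 𝕂] [IsAlgClosed 𝕂] [AddCommGroup V] [Module 𝕂 V]
    [FiniteDimensional 𝕂 V] [Nontrivial V] {d : ℕ} (hd : 1 ≤ d)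
    (Φ : TDSystem 𝕂 V d) (q a b : 𝕂) (hΦ : Φ.IsQRacah q a b) :
    (∃! K : (Module.End 𝕂 V)ˣ, Φ.IsK q K) ∧
    (∃! B : (Module.End 𝕂 V)ˣ, Φ.secondInversion.IsK q B) ∧
    ∀ K B : (Module.End 𝕂 V)ˣ, Φ.IsK q K → Φ.secondInversion.IsK q B →
      (∃! ψ : Module.End 𝕂 V, Φ.IsPsi q a K ψ) ∧
      ∀ ψ : Module.End 𝕂 V, Φ.IsPsi q a K ψ →
        (∃! ρ : Uq q →ₐ[𝕂] Module.End 𝕂 V, Uq.ActsBy q ρ ψ (Φ.R a K) K) ∧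
        (∃! ρ' : Uq q →ₐ[𝕂] Module.End 𝕂 V,
          Uq.ActsBy q ρ' ψ (Φ.secondInversion.R a⁻¹ B) B) ∧
        ∀ ρ ρ' : Uq q →ₐ[𝕂] Module.End 𝕂 V,
          Uq.ActsBy q ρ ψ (Φ.R a K) K →
          Uq.ActsBy q ρ' ψ (Φ.secondInversion.R a⁻¹ B) B →
          ρ (Uq.casimir q) = ρ' (Uq.casimir q) := by
  have hs := hΦ.sub_inv_ne_zero
  have h₂ := hΦ.secondInversion
  refine ⟨hΦ.existsUnique_isK, h₂.existsUnique_isK, fun K B hK hB =>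
    ⟨hΦ.existsUnique_isPsi hK, fun ψ hψ => ?_⟩⟩
  obtain ⟨ψ₂, hψ₂, -⟩ := h₂.existsUnique_isPsi hB
  obtain ⟨rfl, hcas⟩ := hΦ.psi_eq_and_casimir_eq hK hψ hB hψ₂
  refine ⟨Uq.existsUnique_actsBy hs (hΦ.isUqTriple hK hψ),
    Uq.existsUnique_actsBy hs (h₂.isUqTriple hB hψ₂), fun ρ ρ' hρ hρ' => ?_⟩
  rw [hρ.casimir_eq hs, hρ'.casimir_eq hs, hcas]
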